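/- Consider the infinite hexagonal grid, i.e. the graph whose vertices and edges are the corners and sides of the tiling of the plane by regular hexagons. A fire breaks out at a single vertex $f$ on turn $1$. On every even turn firefighters protect some vertices that are not on fire, and on every odd turn after the first the fire spreads from the burning vertices to all adjacent unprotected vertices; burning vertices stay on fire and protected vertices stay protected. The fire is contained if on some turn all but finitely many vertices are saved, where a vertex is saved if it is protected or lies in a component of the subgraph induced by the vertices that are not protected which contains no burning vertex. For every starting vertex $f$ there is a strategy for the firefighters such that, for every integer $\tau\ge 1$, if one additional firefighter is available on turn $2\tau$, so that at most two vertices are protected on turn $2\tau$ and at most one vertex on every other even turn, then the strategy contains the fire. The strategy does not need to know $\tau$ in advance: the vertices that it protects on a turn $2t$ do not depend on $\tau$ as long as $\tau>t$. -/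

import Mathlib

namespace Firefighter

/-- The set of protected vertices on turn `n`, when the firefighters newly protect the set `A s`
on the even turn `2 * s`, for `s = 1, 2, 3, …` (the entry `A 0` is never used). -/
def protectedOn {V : Type*} (A : ℕ → Finset V) (n : ℕ) : Set V :=
  {v | ∃ s : ℕ, 1 ≤ s ∧ 2 * s ≤ n ∧ v ∈ A s}

/-- The set of vertices on fire on turn `n`, when the fire starts on turn `1` at the set `F₀`. On
even turns nothing new burns. On the odd turns `3, 5, 7, …` the set of burning vertices becomes its
closed neighborhood except for the protected vertices. (Turn `0` is not part of the process.) -/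
def fireOn {V : Type*} (G : SimpleGraph V) (F₀ : Set V) (A : ℕ → Finset V) : ℕ → Set V
  | 0 => F₀
  | 1 => F₀
  | n + 2 =>
    if Even (n + 2) then fireOn G F₀ A (n + 1)
    else {v | v ∈ fireOn G F₀ A (n + 1) ∨ ∃ u ∈ fireOn G F₀ A (n + 1), G.Adj u v} \
      protectedOn A (n + 1)

/-- The moves `A` are legal with `b t` firefighters on turn `2 * t`: on each even turn at most that
many vertices are newly protected, and none of them is on fire. -/
def IsLegal {V : Type*} (G : SimpleGraph V) (F₀ : Set V) (b : ℕ → ℕ) (A : ℕ → Finset V) : Prop :=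
  ∀ t : ℕ, 1 ≤ t → (A t).card ≤ b t ∧ ∀ v ∈ A t, v ∉ fireOn G F₀ A (2 * t - 1)

/-- The vertex `v` is saved on turn `n`: it is protected, or it lies in a component of the subgraph
induced by the vertices that are not protected, and that component has no burning vertex. -/
def IsSavedOn {V : Type*} (G : SimpleGraph V) (F₀ : Set V) (A : ℕ → Finset V) (n : ℕ) (v : V) :
    Prop :=
  v ∈ protectedOn A n ∨
    ∃ hv : v ∈ (protectedOn A n)ᶜ, ∀ (u : V) (hu : u ∈ (protectedOn A n)ᶜ),
      u ∈ fireOn G F₀ A n → ¬ (G.induce (protectedOn A n)ᶜ).Reachable ⟨v, hv⟩ ⟨u, hu⟩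

/-- The fire is contained by the moves `A`: on some turn all but finitely many vertices are
saved. -/
def IsContained {V : Type*} (G : SimpleGraph V) (F₀ : Set V) (A : ℕ → Finset V) : Prop :=
  ∃ n : ℕ, 1 ≤ n ∧ {v : V | ¬ IsSavedOn G F₀ A n v}.Finite

/-- Let `A τ` be the moves that are made when the extra firefighter turns up on turn `2 * τ`. The
firefighters do not know `τ` in advance: what they do on a turn `2 * t` before the extra firefighter
turns up is the same for all `τ > t`. -/
def IsNonanticipating {V : Type*} (A : ℕ → ℕ → Finset V) : Prop :=
  ∀ τ τ' t : ℕ, 1 ≤ t → t < τ → t < τ' → A τ t = A τ' t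

/-- The vertices of the hexagonal grid: the pair `(i, j)` stands for the point
`(i * √3 / 2, j / 2)` of the plane, which is a corner of the tiling by regular hexagons of side
length `1` exactly when `(i mod 2, j mod 6)` is one of the four pairs below. -/
def HexVertex : Type :=
  {p : ℤ × ℤ // (p.1 % 2, p.2 % 6) ∈ ({(0, 0), (0, 2), (1, 3), (1, 5)} : Set (ℤ × ℤ))}

/-- The infinite hexagonal grid. Two vertices are adjacent when the corresponding points of the
plane are at Euclidean distance `1`, that is,
`((i - i') * √3 / 2) ^ 2 + ((j - j') / 2) ^ 2 = 1`. -/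
def hexGrid : SimpleGraph HexVertex where
  Adj u v := 3 * (u.1.1 - v.1.1) ^ 2 + (u.1.2 - v.1.2) ^ 2 = 4
  symm := ⟨fun u v h => by linarith [h]⟩
  loopless := ⟨fun u h => by simp at h⟩

end Firefighter

namespace Firefighter

/-! ### Containment from a lower bound on arrival times. -/

section Criterion

variable {V : Type*} {G : SimpleGraph V} {A : ℕ → Finset V}

/-! Draw the grid as a brick wall and list the barrier around a finite region in order of
protection. The extra firefighter puts every vertex after the `τ`-th one turn ahead, so `barrier τ
i` may have index up to `arrival + 2` rather than `arrival + 1` at a burning neighbor. This gain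
turns the wedge into a strip. A horizontal wall needs only every other vertex, so building the upper
wall alone outruns the fire; the lead gained suffices to go around the abandoned end of the lower
wall. `exists_barrier_eq` checks these deadlines, `arrival_le_of_adj` checks the time bound, and
`isLegal_and_isContained_of_potential` concludes. -/

theorem fireOn_even (F₀ : Set V) (k : ℕ) :
    fireOn G F₀ A (2 * k + 2) = fireOn G F₀ A (2 * k + 1) := by
  have h : Even (2 * k + 2) := ⟨k + 1, by ring⟩
  rw [fireOn, if_pos h]

theorem mem_fireOn_odd (F₀ : Set V) (k : ℕ) (v : V) :
    v ∈ fireOn G F₀ A (2 * k + 3) ↔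
      (v ∈ fireOn G F₀ A (2 * k + 1) ∨ ∃ u ∈ fireOn G F₀ A (2 * k + 1), G.Adj u v) ∧
        v ∉ protectedOn A (2 * k + 2) := by
  have h : ¬ Even (2 * k + 1 + 2) := by
    rw [Nat.not_even_iff_odd]; exact ⟨k + 1, by ring⟩
  rw [show 2 * k + 3 = 2 * k + 1 + 2 by ring, fireOn, if_neg h, fireOn_even]
  rfl

/-- If `g` bounds the arrival times of the fire inside a region from below, and every exit of the
region is protected before the fire can use it, then the fire stays in the region. -/
theorem fireOn_subset_of_potential {f : V} {R : Set V} {g : V → ℤ} (hf : f ∈ R) (hgf : g f ≤ 0)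
    (hstep : ∀ u ∈ R, ∀ v, G.Adj u v →
      (v ∈ R ∧ g v ≤ g u + 1) ∨ ∃ s : ℕ, 1 ≤ s ∧ (s : ℤ) ≤ g u + 1 ∧ v ∈ A s) (k : ℕ) :
    ∀ v ∈ fireOn G {f} A (2 * k + 1), v ∈ R ∧ g v ≤ k := by
  induction k with
  | zero =>
    intro v hv
    obtain rfl : v = f := by simpa [fireOn] using hv
    exact ⟨hf, by simpa using hgf⟩
  | succ k ih =>
    intro v hv
    obtain ⟨hv | ⟨u, hu, huv⟩, hp⟩ := (mem_fireOn_odd {f} k v).1 hv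
    · exact ⟨(ih v hv).1, by push_cast; linarith [(ih v hv).2]⟩
    · obtain ⟨huR, hgu⟩ := ih u hu
      rcases hstep u huR v huv with ⟨hvR, hgv⟩ | ⟨s, hs, hsg, hvs⟩
      · exact ⟨hvR, by push_cast; linarith⟩
      · exact absurd ⟨s, hs, by omega, hvs⟩ hp

theorem isLegal_and_isContained_of_potential {f : V} {b : ℕ → ℕ} {R : Set V} {g : V → ℤ}
    (hfin : R.Finite) (hf : f ∈ R) (hgf : g f ≤ 0) (hcard : ∀ t, 1 ≤ t → (A t).card ≤ b t)
    (hdisj : ∀ t, 1 ≤ t → ∀ v ∈ A t, v ∉ R)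
    (hstep : ∀ u ∈ R, ∀ v, G.Adj u v →
      (v ∈ R ∧ g v ≤ g u + 1) ∨ ∃ s : ℕ, 1 ≤ s ∧ (s : ℤ) ≤ g u + 1 ∧ v ∈ A s) :
    IsLegal G {f} b A ∧ IsContained G {f} A := by
  have hfire := fireOn_subset_of_potential hf hgf hstep
  refine ⟨fun t ht => ⟨hcard t ht, fun v hv hb => hdisj t ht v hv ?_⟩, ?_⟩
  · obtain ⟨k, rfl⟩ := Nat.exists_eq_add_of_le' ht
    exact (hfire k v (by simpa [mul_add] using hb)).1
  obtain ⟨M, hM⟩ := (hfin.image g).bddAbove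
  -- By turn `2 * k + 2` every exit of `R` is protected, so an unprotected path from outside cannot
  -- enter `R`, where all the fire is.
  set k : ℕ := M.toNat with hk
  have hgk : ∀ u ∈ R, g u ≤ k := fun u hu => by
    have := hM (Set.mem_image_of_mem g hu)
    omega
  have hexit : ∀ u ∈ R, ∀ v, G.Adj u v → v ∉ R → v ∈ protectedOn A (2 * k + 2) := by
    intro u hu v huv hv
    rcases hstep u hu v huv with ⟨hvR, -⟩ | ⟨s, hs, hsg, hvs⟩
    · exact absurd hvR hv
    · exact ⟨s, hs, by have := hgk u hu; omega, hvs⟩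
  refine ⟨2 * k + 2, by omega, hfin.subset fun v hv => ?_⟩
  by_contra hvR
  refine hv ?_
  by_cases hp : v ∈ protectedOn A (2 * k + 2)
  · exact Or.inl hp
  refine Or.inr ⟨hp, fun u hu hb hreach => ?_⟩
  have huR : u ∈ R := (hfire k u (by rwa [fireOn_even] at hb)).1
  obtain ⟨w⟩ := hreach
  have hout : ∀ (a c : ((protectedOn A (2 * k + 2))ᶜ : Set V)),
      (G.induce (protectedOn A (2 * k + 2))ᶜ).Walk a c → a.1 ∉ R → c.1 ∉ R := by
    intro a c w
    induction w with
    | nil => exact id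
    | @cons a b c hab _ ih =>
      intro ha
      refine ih fun hbR => ?_
      exact a.2 (hexit b.1 hbR a.1 (SimpleGraph.comap_adj.1 hab).symm ha)
  exact hout _ _ w hvR huR

end Criterion

/-! ### The hexagonal grid as a brick wall. -/

section Coordinates

/-- Adjacency in the brick wall, the drawing of the hexagonal grid on `ℤ × ℤ` whose rows are
horizontal lines and in which `(x, y)` is joined to `(x, y + 1)` when `x + y` is even. -/
def BrickAdj (p q : ℤ × ℤ) : Prop :=
  (q.2 = p.2 ∧ (q.1 = p.1 + 1 ∨ q.1 = p.1 - 1)) ∨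
    (q.1 = p.1 ∧ (((p.1 + p.2) % 2 = 0 ∧ q.2 = p.2 + 1) ∨ ((p.1 + p.2) % 2 = 1 ∧ q.2 = p.2 - 1)))

theorem hexVertex_mod (v : HexVertex) :
    (v.1.1 % 2 = 0 ∧ v.1.2 % 6 = 0) ∨ (v.1.1 % 2 = 0 ∧ v.1.2 % 6 = 2) ∨
      (v.1.1 % 2 = 1 ∧ v.1.2 % 6 = 3) ∨ (v.1.1 % 2 = 1 ∧ v.1.2 % 6 = 5) := by
  simpa [Prod.ext_iff] using v.2

/-- The coordinates of a vertex of the hexagonal grid in the brick wall. -/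
def brickEquiv : HexVertex ≃ ℤ × ℤ where
  -- The zigzag with second coordinates `3 * y - 1` and `3 * y` is straightened into row `y`.
  toFun v := (v.1.1, (v.1.2 + 1) / 3)
  invFun p := ⟨(p.1, if (p.1 + p.2) % 2 = 0 then 3 * p.2 else 3 * p.2 - 1), by
    simp only [Set.mem_insert_iff, Set.mem_singleton_iff, Prod.mk.injEq]
    split_ifs <;> omega⟩
  left_inv v := by
    have := hexVertex_mod v
    refine Subtype.ext (Prod.ext rfl ?_)
    dsimp only
    split_ifs <;> omega
  right_inv p := by
    refine Prod.ext rfl ?_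
    dsimp only
    split_ifs <;> omega

theorem brickEquiv_apply (v : HexVertex) : brickEquiv v = (v.1.1, (v.1.2 + 1) / 3) := rfl

theorem brickAdj_of_adj {u v : HexVertex} (h : hexGrid.Adj u v) :
    BrickAdj (brickEquiv u) (brickEquiv v) := by
  have h : 3 * (u.1.1 - v.1.1) ^ 2 + (u.1.2 - v.1.2) ^ 2 = 4 := h
  have hu := hexVertex_mod u
  have hv := hexVertex_mod v
  have h1 : u.1.1 - v.1.1 ≤ 1 := by nlinarith [sq_nonneg (u.1.2 - v.1.2)]
  have h2 : -1 ≤ u.1.1 - v.1.1 := by nlinarith [sq_nonneg (u.1.2 - v.1.2)]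
  have h3 : u.1.2 - v.1.2 ≤ 2 := by nlinarith [sq_nonneg (u.1.1 - v.1.1)]
  have h4 : -2 ≤ u.1.2 - v.1.2 := by nlinarith [sq_nonneg (u.1.1 - v.1.1)]
  simp only [BrickAdj, brickEquiv_apply]
  generalize hx : u.1.1 - v.1.1 = a at *
  generalize hy : u.1.2 - v.1.2 = b at *
  interval_cases a <;> interval_cases b <;> omega

/-- Every vertex of the hexagonal grid can be taken as the origin of the brick wall. -/
theorem exists_brick_coordinates (f : HexVertex) :
    ∃ e : HexVertex ≃ ℤ × ℤ, e f = (0, 0) ∧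
      ∀ u v, hexGrid.Adj u v → BrickAdj (e u) (e v) := by
  obtain ⟨a, b, hab⟩ : ∃ a b, brickEquiv f = (a, b) := ⟨_, _, rfl⟩
  rcases Int.emod_two_eq_zero_or_one (a + b) with hpar | hpar
  · refine ⟨brickEquiv.trans ⟨fun p => (p.1 - a, p.2 - b), fun p => (p.1 + a, p.2 + b),
      fun p => by simp, fun p => by simp⟩, by simp [hab], fun u v h => ?_⟩
    have := brickAdj_of_adj h
    simp only [BrickAdj, Equiv.trans_apply, Equiv.coe_fn_mk] at this ⊢
    omega
  -- At an odd vertex the vertical edge points down; reflecting the rows makes it point up.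
  · refine ⟨brickEquiv.trans ⟨fun p => (p.1 - a, b - p.2), fun p => (p.1 + a, b - p.2),
      fun p => by simp, fun p => by simp⟩, by simp [hab], fun u v h => ?_⟩
    have := brickAdj_of_adj h
    simp only [BrickAdj, Equiv.trans_apply, Equiv.coe_fn_mk] at this ⊢
    omega

end Coordinates

/-! ### The barrier, its region and the deadlines. -/

section Strategy

/-- The vertices of the barrier, in the order in which they are protected. Up to a turn beyond `τ`
the fire is kept in a wedge of angle `120°`, then in a strip between the rows `-τ` and `τ`; finally
the lower wall of the strip is abandoned and the upper one is led around its end and back to it. -/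
def barrier (τ : ℕ) (i : ℕ) : ℤ × ℤ :=
  if i ≤ 2 * τ + 1 then
    if i % 2 = 0 then ((i : ℤ) / 2 - 2, (i : ℤ) / 2) else ((i : ℤ) / 2 - 1, -((i : ℤ) / 2))
  -- The parity of `i` selects exactly the vertices with an edge into the strip.
  else if i ≤ 26 * τ + 1 then ((i : ℤ) - τ - 2, if i % 2 = 0 then (τ : ℤ) + 1 else -τ - 1)
  else if i ≤ 27 * τ + 2 then (2 * (i : ℤ) - 27 * τ - 4, (τ : ℤ) + 1)
  else if i ≤ 30 * τ + 3 then ((i : ℤ) - 1, 28 * (τ : ℤ) + 3 - i)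
  else if i ≤ 35 * τ + 4 then (60 * (τ : ℤ) + 6 - i, 28 * (τ : ℤ) + 3 - i)
  else if i ≤ 44 * τ + 4 then (95 * (τ : ℤ) + 10 - 2 * i, -(7 * (τ : ℤ)) - 2)
  else (51 * (τ : ℤ) + 5 - i, (i : ℤ) - 51 * τ - 6)

/-- The region in which the fire is confined. -/
def region (τ : ℕ) : Set (ℤ × ℤ) :=
  {p | 0 ≤ p.1 + p.2 ∧ p.1 + p.2 ≤ 28 * τ + 1 ∧ -1 ≤ p.1 - p.2 ∧ p.1 - p.2 ≤ 32 * τ + 2 ∧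
    -(7 * (τ : ℤ)) - 1 ≤ p.2 ∧ p.2 ≤ τ ∧
    ¬ (p.2 = -(τ : ℤ) - 1 ∧ p.1 < 25 * τ + 1 ∧ (p.1 + p.2) % 2 = 0)}

/-- A lower bound for the time that the fire needs to reach a vertex inside `region τ`. -/
def arrival (τ : ℕ) (p : ℤ × ℤ) : ℤ :=
  if -(τ : ℤ) ≤ p.2 then p.1 + max p.2 (-p.2)
  -- Below the strip, each term is `26 * τ + 2`, the time at the end `(25 * τ + 1, -τ - 1)` of the
  -- lower wall, plus a lower bound for the distance from there.
  else max (p.1 - p.2) (max (50 * τ + 2 - p.1 - p.2)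
    (24 * τ + 1 - 2 * p.2 - (if (p.1 + p.2) % 2 = 0 then 1 else 0)))

theorem mem_region {τ : ℕ} {x y : ℤ} : (x, y) ∈ region τ ↔
    0 ≤ x + y ∧ x + y ≤ 28 * τ + 1 ∧ -1 ≤ x - y ∧ x - y ≤ 32 * τ + 2 ∧
      -(7 * (τ : ℤ)) - 1 ≤ y ∧ y ≤ τ ∧ ¬ (y = -(τ : ℤ) - 1 ∧ x < 25 * τ + 1 ∧ (x + y) % 2 = 0) :=
  Iff.rfl

theorem region_finite (τ : ℕ) : (region τ).Finite := by
  refine (Set.finite_Icc ((-(40 * (τ : ℤ)) - 40, -(40 * (τ : ℤ)) - 40) : ℤ × ℤ)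
    (40 * (τ : ℤ) + 40, 40 * (τ : ℤ) + 40)).subset fun ⟨x, y⟩ hp => ?_
  rw [mem_region] at hp
  simp only [Set.mem_Icc, Prod.le_def]
  omega

theorem barrier_notMem_region (τ i : ℕ) : barrier τ i ∉ region τ := by
  simp only [barrier]
  split_ifs <;> rw [mem_region] <;> omega

/-- The wedge formula does not involve `τ`, which makes the strategy nonanticipating. -/
theorem barrier_eq_of_le {τ τ' i : ℕ} (h : i ≤ τ) (h' : i ≤ τ') : barrier τ i = barrier τ' i := by
  simp only [barrier, show i ≤ 2 * τ + 1 by omega, show i ≤ 2 * τ' + 1 by omega, if_true]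

theorem arrival_le_of_adj {τ : ℕ} {p q : ℤ × ℤ} (hp : p ∈ region τ) (hq : q ∈ region τ)
    (h : BrickAdj p q) : arrival τ q ≤ arrival τ p + 1 := by
  obtain ⟨x, y⟩ := p
  obtain ⟨x', y'⟩ := q
  simp only [mem_region, BrickAdj] at hp hq h
  simp only [arrival]
  split_ifs <;> omega

set_option maxHeartbeats 1000000 in
/-- A vertex outside the region next to one inside belongs to the barrier, and comes early enough
in it. -/
theorem exists_barrier_eq {τ : ℕ} (hτ : 1 ≤ τ) {p q : ℤ × ℤ} (hp : p ∈ region τ)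
    (hq : q ∉ region τ) (h : BrickAdj p q) :
    ∃ i : ℕ, 1 ≤ i ∧ barrier τ i = q ∧
      ((i : ℤ) ≤ arrival τ p + 1 ∨ τ < i ∧ (i : ℤ) ≤ arrival τ p + 2) := by
  obtain ⟨x, y⟩ := p
  obtain ⟨a, b⟩ := q
  have key : ∀ k : ℤ, 1 ≤ k → barrier τ k.toNat = (a, b) →
      (k ≤ arrival τ (x, y) + 1 ∨ τ < k ∧ k ≤ arrival τ (x, y) + 2) →
      ∃ i : ℕ, 1 ≤ i ∧ barrier τ i = (a, b) ∧
        ((i : ℤ) ≤ arrival τ (x, y) + 1 ∨ τ < i ∧ (i : ℤ) ≤ arrival τ (x, y) + 2) := by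
    intro k hk hb hle
    exact ⟨k.toNat, by omega, hb, by omega⟩
  simp only [mem_region, BrickAdj] at hp hq h
  -- One case per stretch of the barrier; each `key` inverts the formula of `barrier` there.
  have hcases : (a + b = -1 ∧ -(τ : ℤ) ≤ b) ∨ (a + b = -1 ∧ b < -(τ : ℤ) - 1) ∨ a - b = -2 ∨
      (b = τ + 1 ∧ a < 25 * τ) ∨ (b = τ + 1 ∧ 25 * τ ≤ a) ∨ a + b = 28 * τ + 2 ∨
      a - b = 32 * τ + 3 ∨ b = -(7 * (τ : ℤ)) - 2 ∨
      (b = -(τ : ℤ) - 1 ∧ 0 ≤ a + b ∧ a < 25 * τ + 1 ∧ (a + b) % 2 = 0) := by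
    omega
  clear hq
  rcases hcases with hc | hc | hc | hc | hc | hc | hc | hc | hc
  · refine key (-2 * b + 1) (by omega) ?_ ?_ <;> simp only [barrier, arrival] <;> split_ifs <;>
      (try rw [Prod.mk.injEq]) <;> omega
  · refine key (51 * τ + 6 + b) (by omega) ?_ ?_ <;> simp only [barrier, arrival] <;> split_ifs <;>
      (try rw [Prod.mk.injEq]) <;> omega
  · refine key (2 * b) (by omega) ?_ ?_ <;> simp only [barrier, arrival] <;> split_ifs <;>
      (try rw [Prod.mk.injEq]) <;> omega
  · refine key (a + τ + 2) (by omega) ?_ ?_ <;> simp only [barrier, arrival] <;> split_ifs <;>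
      (try rw [Prod.mk.injEq]) <;> omega
  · refine key ((a + 27 * τ + 4) / 2) (by omega) ?_ ?_ <;> simp only [barrier, arrival] <;> split_ifs <;>
      (try rw [Prod.mk.injEq]) <;> omega
  · refine key (28 * τ + 3 - b) (by omega) ?_ ?_ <;> simp only [barrier, arrival] <;> split_ifs <;>
      (try rw [Prod.mk.injEq]) <;> omega
  · refine key (28 * τ + 3 - b) (by omega) ?_ ?_ <;> simp only [barrier, arrival] <;> split_ifs <;>
      (try rw [Prod.mk.injEq]) <;> omega
  · refine key ((95 * τ + 10 - a) / 2) (by omega) ?_ ?_ <;> simp only [barrier, arrival] <;> split_ifs <;>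
      (try rw [Prod.mk.injEq]) <;> omega
  · refine key (a + τ + 2) (by omega) ?_ ?_ <;> simp only [barrier, arrival] <;> split_ifs <;>
      (try rw [Prod.mk.injEq]) <;> omega

/-- The vertices of the barrier are protected one by one, but two of them on turn `2 * τ`. -/
def moves (τ t : ℕ) : Finset (ℤ × ℤ) :=
  if t < τ then {barrier τ t}
  else if t = τ then {barrier τ t, barrier τ (t + 1)}
  else {barrier τ (t + 1)}

theorem card_moves_le (τ t : ℕ) : (moves τ t).card ≤ if t = τ then 2 else 1 := by
  rw [moves]
  split_ifs
  · omega
  · simp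
  · exact Finset.card_le_two
  · simp

theorem exists_eq_barrier_of_mem_moves {τ t : ℕ} {p : ℤ × ℤ} (h : p ∈ moves τ t) :
    ∃ i, p = barrier τ i := by
  rw [moves] at h
  split_ifs at h
  · exact ⟨t, by simpa using h⟩
  · simp only [Finset.mem_insert, Finset.mem_singleton] at h
    rcases h with h | h <;> exact ⟨_, h⟩
  · exact ⟨t + 1, by simpa using h⟩

theorem barrier_mem_moves {τ i : ℕ} (h : i ≤ τ) : barrier τ i ∈ moves τ i := by
  rw [moves]
  split_ifs
  · simp
  · simp
  · omega

theorem barrier_succ_mem_moves {τ i : ℕ} (h : τ ≤ i) : barrier τ (i + 1) ∈ moves τ i := by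
  rw [moves, if_neg (by omega)]
  split_ifs <;> simp

theorem moves_eq_of_lt {τ τ' t : ℕ} (h : t < τ) (h' : t < τ') : moves τ t = moves τ' t := by
  rw [moves, moves, if_pos h, if_pos h', barrier_eq_of_le h.le h'.le]

end Strategy

end Firefighter

theorem theorem2 (f : Firefighter.HexVertex) :
    ∃ A : ℕ → ℕ → Finset Firefighter.HexVertex,
      Firefighter.IsNonanticipating A ∧
      ∀ τ : ℕ, 1 ≤ τ →
        Firefighter.IsLegal Firefighter.hexGrid {f} (fun t => if t = τ then 2 else 1) (A τ) ∧
        Firefighter.IsContained Firefighter.hexGrid {f} (A τ) := by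
  open Firefighter in
  obtain ⟨e, hef, hadj⟩ := exists_brick_coordinates f
  refine ⟨fun τ t => (moves τ t).map e.symm.toEmbedding, fun τ τ' t _ h h' => ?_, fun τ hτ => ?_⟩
  · simp only [moves_eq_of_lt h h']
  have hmem : ∀ {t v}, e v ∈ moves τ t → v ∈ (moves τ t).map e.symm.toEmbedding :=
    fun {t v} h => Finset.mem_map_equiv.2 (by simpa using h)
  refine isLegal_and_isContained_of_potential (R := e ⁻¹' region τ) (g := fun v => arrival τ (e v))
    ((region_finite τ).preimage e.injective.injOn) ?_ ?_ (fun t _ => ?_) (fun t _ v hv hR => ?_)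
    (fun u hu v huv => ?_)
  · rw [Set.mem_preimage, hef, mem_region]
    omega
  · simp [hef, arrival]
  · rw [Finset.card_map]
    exact card_moves_le τ t
  · obtain ⟨i, hi⟩ := exists_eq_barrier_of_mem_moves (Finset.mem_map_equiv.1 hv)
    rw [Equiv.symm_symm] at hi
    exact barrier_notMem_region τ i (hi ▸ hR)
  · by_cases hv : e v ∈ region τ
    · exact Or.inl ⟨hv, arrival_le_of_adj hu hv (hadj u v huv)⟩
    right
    obtain ⟨i, hi, hiv, hle⟩ := exists_barrier_eq hτ hu hv (hadj u v huv)
    by_cases hiτ : i ≤ τ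
    · exact ⟨i, hi, by omega, hmem (hiv ▸ barrier_mem_moves hiτ)⟩
    · obtain ⟨j, rfl⟩ := Nat.exists_eq_add_of_le' hi
      refine ⟨j, by omega, by push_cast at hle; omega, hmem ?_⟩
      rw [← hiv]
      exact barrier_succ_mem_moves (by omega)
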